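/- **Model.** For $T,d\ge 1$, a matrix $A\in\mathbb R^{d\times d}$, a permutation $\pi$ of $[T]=\{1,\dots,T\}$ and $\sigma\ge 0$, let $\xi_1,\dots,\xi_T,\tilde\xi_1,\dots,\tilde\xi_T$ be i.i.d. standard Gaussian vectors in $\mathbb R^d$, and set $x_1=\xi_1$, $x_{t+1}=Ax_t+\xi_{t+1}$, $\tilde x_1=\tilde\xi_1$, $\tilde x_{t+1}=A\tilde x_t+\tilde\xi_{t+1}$ for $1\le t<T$. Put $x^\#_t=x_{\pi(t)}+\sigma\tilde x_{\pi(t)}$ for $t\in[T]$. The pair of $d\times T$ matrices $X=[x_1\cdots x_T]$, $X^\#=[x^\#_1\cdots x^\#_T]$ is a realization of $\mathrm{CVAR}(1,d,T;A,\pi,\sigma)$. A linear assignment estimator is a (measurable) random permutation $\hat\pi$ whose permutation matrix, with rows $e_{\hat\pi(1)}^\top,\dots,e_{\hat\pi(T)}^\top$, almost surely maximizes $\Pi\mapsto\langle X^\#\Pi,X\rangle_F$ over all $T\times T$ permutation matrices. **Theorem.** For every $T\in\mathbb N$ let $d=d_T\ge1$, let $A^*=A^*_T\in\mathbb R^{d\times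 d}$ have spectral norm $\|A^*\|_2<1$, let $\pi^*=\pi^*_T$ be a permutation of $[T]$ and $\sigma=\sigma_T\ge0$ (all of these may depend on $T$; the dimension and $A^*$ may in particular be constant). Let $(X,X^\#)$ be drawn from $\mathrm{CVAR}(1,d,T;A^*,\pi^*,\sigma)$, let $\hat\pi_{\mathrm{LA}}$ be a linear assignment estimator, let $\mathcal E=\{t\in[T]:\hat\pi_{\mathrm{LA}}(t)\ne\pi^*(t)\}$, and let $s_0=2^{1/d}$. 1. If there is a real sequence $w(T)\to\infty$ such that, for all sufficiently large $T$, $$\sigma^2\le\frac{(1-\|A^*\|_2)^5}{4\,(s_0^{w(T)}T^{4/d}-1)},$$ then $\mathbb E|\mathcal E|\to0$ and $\mathbb P(|\mathcal E|=0)\to1$ as $T\to\infty$. 2. If there is a bounded real sequence $c(T)$ such that, for all sufficiently large $T$, $$\sigma^2\le\frac{(1-\|A^*\|_2)^5}{4\,(s_0^{c(T)}T^{4/d}-1)},$$ then $\mathbb E|\mathcal E|=O(1)$ as $T\to\infty$, and for every $f$ with $f(T)\to\infty$ one has $\mathbb P(|\mathcal E|\le f(T))\to1$. 3. If there is a real sequence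 $w(T)\to\infty$ such that, for all sufficiently large $T$, $$\sigma^2\le\frac{(1-\|A^*\|_2)^5}{4\,(s_0^{w(T)}T^{2/d}-1)},$$ then, as $T\to\infty$, $$\mathbb E|\mathcal E|=O\!\left(\Big(\frac{(1-\|A^*\|_2)^5}{4\sigma^2}+1\Big)^{-d/2}T^2\right),$$ where the right-hand side is read as its limit $0$ for those $T$ with $\sigma_T=0$. -/

import Mathlib

open MeasureTheory ProbabilityTheory Filter Topology Asymptotics

noncomputable section

/-- The spectral norm `‖A‖₂`: the operator norm of `A` on Euclidean space. -/
def specNorm {d : ℕ} (A : Matrix (Fin d) (Fin d) ℝ) : ℝ :=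
  ‖Matrix.toEuclideanCLM (n := Fin d) (𝕜 := ℝ) A‖

/-- `x` is the vector autoregressive series of order one with system matrix `A` driven by the
innovations `ξ`: `x₁ = ξ₁` and `xₜ₊₁ = A xₜ + ξₜ₊₁`. (The time `t` is the element `t - 1` of
`Fin T`.) -/
def IsVAR {d T : ℕ} (A : Matrix (Fin d) (Fin d) ℝ) (ξ x : Fin T → EuclideanSpace ℝ (Fin d)) :
    Prop :=
  (∀ h : 0 < T, x ⟨0, h⟩ = ξ ⟨0, h⟩) ∧
    ∀ (t : ℕ) (h : t + 1 < T),
      x ⟨t + 1, h⟩ =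
        Matrix.toEuclideanCLM (n := Fin d) (𝕜 := ℝ) A (x ⟨t, Nat.lt_of_succ_lt h⟩) + ξ ⟨t + 1, h⟩

/-- The random `d × T` matrices `X` and `Xs` (with columns `xₜ` and `x#ₜ`) are a realization of
the model `CVAR(1, d, T; A, π, σ)`: `x` and `x'` are VAR series with system matrix `A` driven by
mutually independent standard Gaussian vectors, and `x#ₜ = x_{π t} + σ x'_{π t}`. -/
def IsCVAR {Ω : Type*} [MeasurableSpace Ω] (P : Measure Ω) {d T : ℕ}
    (A : Matrix (Fin d) (Fin d) ℝ) (π : Equiv.Perm (Fin T)) (σ : ℝ)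
    (X Xs : Ω → Matrix (Fin d) (Fin T) ℝ) : Prop :=
  ∃ ξ ξ' x x' : Fin T → Ω → EuclideanSpace ℝ (Fin d),
    iIndepFun (Sum.elim ξ ξ') P ∧
    (∀ t, HasLaw (ξ t) (stdGaussian (EuclideanSpace ℝ (Fin d))) P) ∧
    (∀ t, HasLaw (ξ' t) (stdGaussian (EuclideanSpace ℝ (Fin d))) P) ∧
    ∀ ω,
      IsVAR A (fun t => ξ t ω) (fun t => x t ω) ∧
      IsVAR A (fun t => ξ' t ω) (fun t => x' t ω) ∧
      (∀ i t, X ω i t = x t ω i) ∧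
      (∀ i t, Xs ω i t = (x (π t) ω + σ • x' (π t) ω) i)

/-- The Frobenius inner product of two real matrices. -/
def frobeniusInner {m n : ℕ} (M N : Matrix (Fin m) (Fin n) ℝ) : ℝ :=
  (M.transpose * N).trace

/-- `π` is a solution of the linear assignment problem for the data `X, Xs`: its permutation
matrix (with rows `e_{π 1}ᵀ, …, e_{π T}ᵀ`) maximizes `Π ↦ ⟨Xs Π, X⟩_F` over all permutation
matrices. -/
def IsLinearAssignment {d T : ℕ} (X Xs : Matrix (Fin d) (Fin T) ℝ) (π : Equiv.Perm (Fin T)) :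
    Prop :=
  ∀ τ : Equiv.Perm (Fin T),
    frobeniusInner (Xs * Equiv.Perm.permMatrix ℝ τ) X ≤
      frobeniusInner (Xs * Equiv.Perm.permMatrix ℝ π) X

/-- The set of mismatched indices of the estimate `πhat` of `π`. -/
def mismatch {T : ℕ} (πhat π : Equiv.Perm (Fin T)) : Finset (Fin T) :=
  Finset.univ.filter fun t => πhat t ≠ π t

/-- The base `s₀ = 2 ^ (1 / d)`. -/
def sZero (d : ℕ) : ℝ := (2 : ℝ) ^ (1 / (d : ℝ))

/-- The factor `((1 - a)⁵ / (4 σ²) + 1) ^ (-d / 2)`, read as its limit `0` when `σ = 0`. -/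
def errorFactor (d : ℕ) (a σ : ℝ) : ℝ :=
  if σ = 0 then 0 else ((1 - a) ^ 5 / (4 * σ ^ 2) + 1) ^ (-(d : ℝ) / 2)

end

-- Let ρ be the estimate composed with the inverse of the truth. A mismatch at t puts π(t) on a
-- nontrivial cycle of ρ, and undoing that single cycle gives a competitor, so optimality forces the
-- cycle's own contribution to the objective to be nonnegative
-- (`IsLinearAssignment.card_mismatch_le`). With at most T^(n+1) injective tuples of n + 1 times, it
-- suffices that each has nonnegative gain with probability at most u^n, where u is `errorFactor`
-- (`measure_cycleGain_nonneg_le`): the expected error is then at most the sum of T (Tu)^n over n ≥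
-- 1, hence at most 2uT² once Tu ≤ 1/2. The noise conditions bound u.
--
-- For one cycle the gain is -S/2 plus σ times a linear functional of x̃, where S is the sum of
-- squared increments of x around the cycle. Both remaining estimates pass from the series to its
-- innovations by duality (`IsVAR.exists_dual`): with a = ‖A‖₂, a linear functional of the series is
-- one of the white noise, whose coefficient vector changes length by a factor between 1/(1 + a) and
-- 1/(1 - a). The upper factor bounds the conditional variance given x, and a Chernoff bound leaves
-- E exp(-rS). The lower factor controls this Laplace transform: Gaussian linearization of the
-- square turns it into an expectation over an auxiliary path η, which is integrated out one vector
-- at a time, each giving (1 + 2r/(1 + a)²)^(-d/2).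

/-- The sequence on `ℕ` that continues a finite sequence by zero. -/
def extendZero {M : Type*} [Zero M] {n : ℕ} (x : Fin n → M) (j : ℕ) : M :=
  if h : j < n then x ⟨j, h⟩ else 0

lemma extendZero_val {M : Type*} [Zero M] {n : ℕ} (x : Fin n → M) (j : Fin n) :
    extendZero x j = x j := by
  simp [extendZero]

lemma extendZero_of_le {M : Type*} [Zero M] {n : ℕ} (x : Fin n → M) {j : ℕ} (h : n ≤ j) :
    extendZero x j = 0 := by
  simp [extendZero, h]

lemma extendZero_cons_succ {M : Type*} [Zero M] {n : ℕ} (z : M) (x : Fin n → M) (j : ℕ) :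
    extendZero (Fin.cons z x : Fin (n + 1) → M) (j + 1) = extendZero x j := by
  by_cases h : j < n
  · have h' : j + 1 < n + 1 := by omega
    simp only [extendZero, h, h', dite_true]
    exact Fin.cons_succ (α := fun _ => M) z x ⟨j, h⟩
  · simp [extendZero, h]

lemma continuous_extendZero {M : Type*} [Zero M] [TopologicalSpace M] {n : ℕ} (j : ℕ) :
    Continuous fun x : Fin n → M => extendZero x j := by
  by_cases h : j < n <;> simp only [extendZero, h, dite_true, dite_false] <;> fun_prop

/-! ### Gaussian integrals -/

/-- Complete the square against the density: the exponent becomes -b(z - m)² minus a nonnegative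
constant, which is discarded. The bound is thus uniform in the centre c, as the iterated integration
along a path needs. -/
lemma integral_exp_neg_mul_sq_sub_gaussianReal_le {μ : ℝ} (hμ : 0 ≤ μ) (c : ℝ) :
    ∫ z, Real.exp (-(μ * (z - c) ^ 2)) ∂(gaussianReal 0 1) ≤ (1 + 2 * μ) ^ (-(1 / 2) : ℝ) := by
  set b : ℝ := μ + 1 / 2 with hb
  have hb0 : 0 < b := by positivity
  set m : ℝ := μ * c / b
  have hint : Integrable fun z : ℝ => (√(2 * Real.pi))⁻¹ * Real.exp (-b * (z - m) ^ 2) :=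
    ((integrable_exp_neg_mul_sq hb0).comp_sub_right m).const_mul _
  have hval : ∫ z : ℝ, (√(2 * Real.pi))⁻¹ * Real.exp (-b * (z - m) ^ 2)
      = (1 + 2 * μ) ^ (-(1 / 2) : ℝ) := by
    rw [integral_const_mul, integral_sub_right_eq_self (fun z => Real.exp (-b * z ^ 2)) m,
      integral_gaussian, Real.rpow_neg (by positivity), ← Real.sqrt_eq_rpow, ← Real.sqrt_inv,
      ← Real.sqrt_inv, ← Real.sqrt_mul (by positivity)]
    congr 1
    rw [hb]
    field_simp
    ring
  rw [integral_gaussianReal_eq_integral_smul one_ne_zero, ← hval]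
  refine integral_mono_of_nonneg (Eventually.of_forall fun z => ?_) hint
    (Eventually.of_forall fun z => ?_)
  · simp only [smul_eq_mul]
    have := gaussianPDFReal_nonneg 0 1 z
    positivity
  · simp only [gaussianPDFReal, smul_eq_mul, NNReal.coe_one, mul_one, sub_zero]
    rw [mul_assoc, ← Real.exp_add]
    gcongr
    have h1 : b * (z - m) ^ 2 = b * z ^ 2 - 2 * z * (μ * c) + (μ * c) ^ 2 / b := by
      simp only [m]
      field_simp
      ring
    have h2 : (μ * c) ^ 2 / b ≤ μ * c ^ 2 := by
      rw [div_le_iff₀ hb0, hb]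
      nlinarith [mul_nonneg hμ (sq_nonneg c)]
    have : b * z ^ 2 = μ * z ^ 2 + z ^ 2 / 2 := by rw [hb]; ring
    nlinarith

variable {d : ℕ}

lemma integral_exp_neg_mul_norm_sub_sq_stdGaussian_le {μ : ℝ} (hμ : 0 ≤ μ)
    (c : EuclideanSpace ℝ (Fin d)) :
    ∫ z, Real.exp (-(μ * ‖z - c‖ ^ 2)) ∂(stdGaussian (EuclideanSpace ℝ (Fin d)))
      ≤ ((1 + 2 * μ) ^ (-(1 / 2) : ℝ)) ^ d := by
  rw [← map_pi_eq_stdGaussian, integral_map (by fun_prop)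
    (Continuous.aestronglyMeasurable (by fun_prop))]
  have h (x : Fin d → ℝ) : Real.exp (-(μ * ‖WithLp.toLp 2 x - c‖ ^ 2))
      = ∏ i, Real.exp (-(μ * (x i - c i) ^ 2)) := by
    rw [← Real.exp_sum, EuclideanSpace.real_norm_sq_eq, Finset.mul_sum, Finset.sum_neg_distrib]
    rfl
  simp_rw [h]
  rw [integral_fintype_prod_eq_prod (fun i z => Real.exp (-(μ * (z - c i) ^ 2)))]
  calc _ ≤ ∏ i : Fin d, (1 + 2 * μ) ^ (-(1 / 2) : ℝ) := by
        refine Finset.prod_le_prod (fun i _ => integral_nonneg fun z => (Real.exp_pos _).le)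
          fun i _ => integral_exp_neg_mul_sq_sub_gaussianReal_le hμ _
    _ = _ := by simp

lemma lintegral_exp_neg_mul_norm_sub_sq_stdGaussian_le {μ : ℝ} (hμ : 0 ≤ μ)
    (c : EuclideanSpace ℝ (Fin d)) :
    ∫⁻ z, ENNReal.ofReal (Real.exp (-(μ * ‖z - c‖ ^ 2)))
        ∂(stdGaussian (EuclideanSpace ℝ (Fin d)))
      ≤ ENNReal.ofReal (((1 + 2 * μ) ^ (-(1 / 2) : ℝ)) ^ d) := by
  rw [← ofReal_integral_eq_lintegral_ofReal]
  · exact ENNReal.ofReal_le_ofReal (integral_exp_neg_mul_norm_sub_sq_stdGaussian_le hμ c)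
  · refine Integrable.of_bound (Continuous.aestronglyMeasurable (by fun_prop)) 1
      (Eventually.of_forall fun z => ?_)
    rw [Real.norm_of_nonneg (Real.exp_pos _).le, Real.exp_le_one_iff, neg_nonpos]
    positivity
  · exact Eventually.of_forall fun z => (Real.exp_pos _).le

/-- The law of `n` independent standard Gaussian vectors of dimension `d`. -/
noncomputable def gaussianNoise (d n : ℕ) : Measure (Fin n → EuclideanSpace ℝ (Fin d)) :=
  Measure.pi fun _ => stdGaussian (EuclideanSpace ℝ (Fin d))

instance (d n : ℕ) : IsProbabilityMeasure (gaussianNoise d n) := by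
  unfold gaussianNoise
  infer_instance

/-- The squared length of the increments of a path that ends at the origin. -/
noncomputable def incrementEnergy {n : ℕ} (η : Fin n → EuclideanSpace ℝ (Fin d)) : ℝ :=
  ∑ i, ‖η i - extendZero η (i + 1)‖ ^ 2

lemma continuous_incrementEnergy {n : ℕ} :
    Continuous (incrementEnergy : (Fin n → EuclideanSpace ℝ (Fin d)) → ℝ) := by
  unfold incrementEnergy
  refine continuous_finsetSum _ fun i _ => ?_
  have := continuous_extendZero (M := EuclideanSpace ℝ (Fin d)) (n := n) (i + 1)
  fun_prop

lemma incrementEnergy_cons {n : ℕ} (z : EuclideanSpace ℝ (Fin d))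
    (η : Fin n → EuclideanSpace ℝ (Fin d)) :
    incrementEnergy (Fin.cons z η : Fin (n + 1) → EuclideanSpace ℝ (Fin d))
      = ‖z - extendZero η 0‖ ^ 2 + incrementEnergy η := by
  simp only [incrementEnergy, Fin.sum_univ_succ, Fin.cons_zero, Fin.cons_succ, Fin.val_succ,
    extendZero_cons_succ, Fin.val_zero]

/-- The first vector enters only through its distance to the next one. Integrating it with the
others fixed costs one factor, uniformly in that centre, and leaves the energy of a shorter path. -/
lemma lintegral_exp_neg_mul_incrementEnergy_le {μ : ℝ} (hμ : 0 ≤ μ) (n : ℕ) :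
    ∫⁻ η, ENNReal.ofReal (Real.exp (-(μ * incrementEnergy η))) ∂(gaussianNoise d n)
      ≤ ENNReal.ofReal ((((1 + 2 * μ) ^ (-(1 / 2) : ℝ)) ^ d) ^ n) := by
  induction n with
  | zero => simp [incrementEnergy]
  | succ n ih =>
    have hm := continuous_incrementEnergy (d := d) (n := n)
    have hm' := continuous_incrementEnergy (d := d) (n := n + 1)
    have he := continuous_extendZero (M := EuclideanSpace ℝ (Fin d)) (n := n) 0
    rw [gaussianNoise, ← (measurePreserving_piFinSuccAbove
      (fun _ : Fin (n + 1) => stdGaussian (EuclideanSpace ℝ (Fin d))) 0).symm.lintegral_comp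
      (by fun_prop), lintegral_prod_symm' _ (by fun_prop)]
    have h (z : EuclideanSpace ℝ (Fin d)) (η : Fin n → EuclideanSpace ℝ (Fin d)) :
        (MeasurableEquiv.piFinSuccAbove (fun _ : Fin (n + 1) => EuclideanSpace ℝ (Fin d)) 0).symm
          (z, η) = (Fin.cons z η : Fin (n + 1) → EuclideanSpace ℝ (Fin d)) := by
      simp [MeasurableEquiv.piFinSuccAbove, Fin.insertNthEquiv]
    simp_rw [h, incrementEnergy_cons, mul_add, neg_add, Real.exp_add,
      ENNReal.ofReal_mul (Real.exp_pos _).le]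
    calc _ ≤ ∫⁻ η, ENNReal.ofReal (((1 + 2 * μ) ^ (-(1 / 2) : ℝ)) ^ d) *
            ENNReal.ofReal (Real.exp (-(μ * incrementEnergy η))) ∂(gaussianNoise d n) := by
          refine lintegral_mono fun η => ?_
          rw [lintegral_mul_const _ (by fun_prop)]
          gcongr
          exact lintegral_exp_neg_mul_norm_sub_sq_stdGaussian_le hμ _
      _ ≤ _ := by
          rw [lintegral_const_mul _ (by fun_prop), pow_succ', ENNReal.ofReal_mul (by positivity)]
          gcongr

lemma integral_cexp_inner_gaussianNoise {n : ℕ} (c : Fin n → EuclideanSpace ℝ (Fin d)) :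
    ∫ ξ, Complex.exp (((∑ s, inner ℝ (ξ s) (c s) : ℝ) : ℂ) * Complex.I) ∂(gaussianNoise d n)
      = (Real.exp (-(∑ s, ‖c s‖ ^ 2) / 2) : ℝ) := by
  have h (ξ : Fin n → EuclideanSpace ℝ (Fin d)) :
      Complex.exp (((∑ s, inner ℝ (ξ s) (c s) : ℝ) : ℂ) * Complex.I)
        = ∏ s, Complex.exp ((inner ℝ (ξ s) (c s) : ℝ) * Complex.I) := by
    rw [← Complex.exp_sum, Complex.ofReal_sum, Finset.sum_mul]
  simp_rw [h]
  rw [gaussianNoise, integral_fintype_prod_eq_prod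
    (fun s (z : EuclideanSpace ℝ (Fin d)) => Complex.exp ((inner ℝ z (c s) : ℝ) * Complex.I))]
  simp_rw [← charFun_apply, charFun_stdGaussian]
  rw [← Complex.exp_sum]
  push_cast
  congr 1
  rw [← Finset.sum_div, Finset.sum_neg_distrib]

lemma integral_exp_inner_stdGaussian (c : EuclideanSpace ℝ (Fin d)) :
    ∫ z, Real.exp (inner ℝ z c) ∂(stdGaussian (EuclideanSpace ℝ (Fin d)))
      = Real.exp (‖c‖ ^ 2 / 2) := by
  rw [← map_pi_eq_stdGaussian, integral_map (by fun_prop)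
    (Continuous.aestronglyMeasurable (by fun_prop))]
  have h (x : Fin d → ℝ) : Real.exp (inner ℝ (WithLp.toLp 2 x) c)
      = ∏ i, Real.exp (c i * x i) := by
    rw [← Real.exp_sum, PiLp.inner_apply]
    rfl
  simp_rw [h]
  rw [integral_fintype_prod_eq_prod (fun i z => Real.exp (c i * z)),
    EuclideanSpace.real_norm_sq_eq, Finset.sum_div, Real.exp_sum]
  refine Finset.prod_congr rfl fun i _ => ?_
  have := congrFun (mgf_id_gaussianReal (μ := 0) (v := 1)) (c i)
  simpa [mgf] using this

lemma lintegral_exp_inner_gaussianNoise {n : ℕ} (c : Fin n → EuclideanSpace ℝ (Fin d)) :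
    ∫⁻ ξ, ENNReal.ofReal (Real.exp (∑ s, inner ℝ (ξ s) (c s))) ∂(gaussianNoise d n)
      = ENNReal.ofReal (Real.exp ((∑ s, ‖c s‖ ^ 2) / 2)) := by
  have h : ∫ ξ, Real.exp (∑ s, inner ℝ (ξ s) (c s)) ∂(gaussianNoise d n)
      = Real.exp ((∑ s, ‖c s‖ ^ 2) / 2) := by
    simp_rw [Real.exp_sum]
    rw [gaussianNoise, integral_fintype_prod_eq_prod
      (fun s (z : EuclideanSpace ℝ (Fin d)) => Real.exp (inner ℝ z (c s)))]
    simp_rw [integral_exp_inner_stdGaussian]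
    rw [← Real.exp_sum, Finset.sum_div]
  rw [← h, ofReal_integral_eq_lintegral_ofReal]
  -- A non-integrable function has integral 0 by convention, so the positive value just computed
  -- forces integrability.
  · by_contra hc
    rw [integral_undef hc] at h
    exact (Real.exp_pos _).ne h
  · exact Eventually.of_forall fun z => (Real.exp_pos _).le

/-! ### Duality for autoregressive series -/

section Duality

variable {E : Type*} [NormedAddCommGroup E]

/-- The weights 1 and a on the two squares, here and in the lower bound below, are chosen so that
summing over a shifted sequence gives exactly (1 ± a)². -/
lemma norm_sub_sq_le_of_norm_le {p b : E} {a q : ℝ} (ha : 0 ≤ a) (hb : ‖b‖ ≤ a * q) :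
    ‖p - b‖ ^ 2 ≤ (1 + a) * (‖p‖ ^ 2 + a * q ^ 2) := by
  have h1 : ‖p - b‖ ≤ ‖p‖ + a * q := (norm_sub_le p b).trans (by linarith)
  have h2 : ‖p - b‖ ^ 2 ≤ (‖p‖ + a * q) ^ 2 := by gcongr
  nlinarith [mul_nonneg ha (sq_nonneg (‖p‖ - q))]

lemma le_norm_sub_sq_of_norm_le {p b : E} {a q : ℝ} (ha : 0 ≤ a) (ha1 : a ≤ 1)
    (hb : ‖b‖ ≤ a * q) :
    (1 - a) * (‖p‖ ^ 2 - a * q ^ 2) ≤ ‖p - b‖ ^ 2 := by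
  have h1 : ‖p‖ - ‖b‖ ≤ ‖p - b‖ := norm_sub_norm_le p b
  rcases le_total (‖p‖) (a * q) with h | h
  · have h2 : ‖p‖ ^ 2 ≤ (a * q) ^ 2 := by gcongr
    have h3 : ‖p‖ ^ 2 - a * q ^ 2 ≤ 0 := by nlinarith [mul_nonneg ha (sq_nonneg q)]
    nlinarith [sq_nonneg ‖p - b‖]
  · have h2 : (‖p‖ - a * q) ^ 2 ≤ ‖p - b‖ ^ 2 := by
      have : 0 ≤ ‖p‖ - a * q := by linarith
      gcongr
      linarith
    nlinarith [mul_nonneg ha (sq_nonneg (‖p‖ - q))]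

variable [InnerProductSpace ℝ E]

lemma exists_backward_recursion (B : E →L[ℝ] E) (T : ℕ) (v : ℕ → E) :
    ∃ w : ℕ → E, w T = 0 ∧ ∀ s < T, v s = w s - B (w (s + 1)) := by
  -- The Neumann series of the inverse of 1 - B∘shift, finite because the recursion starts from zero
  -- at time T.
  refine ⟨fun s => ∑ j ∈ Finset.range (T - s), (B ^ j) (v (s + j)), by simp, fun s hs => ?_⟩
  simp only
  rw [show T - s = T - (s + 1) + 1 by omega, Finset.sum_range_succ', map_sum, eq_sub_iff_add_eq,
    add_comm]
  congr 1
  refine Finset.sum_congr rfl fun j _ => ?_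
  rw [pow_succ', mul_apply_eq_comp, add_right_comm, add_assoc]

lemma sum_norm_sq_sub_le (B : E →L[ℝ] E) {T : ℕ} {w : ℕ → E} (hT : w T = 0) :
    ∑ s ∈ Finset.range T, ‖w s - B (w (s + 1))‖ ^ 2
      ≤ (1 + ‖B‖) ^ 2 * ∑ s ∈ Finset.range T, ‖w s‖ ^ 2 := by
  have hshift : ∑ s ∈ Finset.range T, ‖w (s + 1)‖ ^ 2 ≤ ∑ s ∈ Finset.range T, ‖w s‖ ^ 2 := by
    have h1 := Finset.sum_range_succ (fun s => ‖w s‖ ^ 2) T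
    have h2 := Finset.sum_range_succ' (fun s => ‖w s‖ ^ 2) T
    rw [hT, norm_zero] at h1
    nlinarith [sq_nonneg ‖w 0‖]
  calc _ ≤ ∑ s ∈ Finset.range T, (1 + ‖B‖) * (‖w s‖ ^ 2 + ‖B‖ * ‖w (s + 1)‖ ^ 2) :=
        Finset.sum_le_sum fun s _ =>
          norm_sub_sq_le_of_norm_le (norm_nonneg B) (B.le_opNorm _)
    _ = (1 + ‖B‖) * (∑ s ∈ Finset.range T, ‖w s‖ ^ 2
          + ‖B‖ * ∑ s ∈ Finset.range T, ‖w (s + 1)‖ ^ 2) := by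
        rw [← Finset.mul_sum, Finset.sum_add_distrib, ← Finset.mul_sum]
    _ ≤ (1 + ‖B‖) * (∑ s ∈ Finset.range T, ‖w s‖ ^ 2
          + ‖B‖ * ∑ s ∈ Finset.range T, ‖w s‖ ^ 2) := by gcongr
    _ = _ := by ring

lemma le_sum_norm_sq_sub (B : E →L[ℝ] E) (hB : ‖B‖ ≤ 1) {T : ℕ} {w : ℕ → E} (hT : w T = 0) :
    (1 - ‖B‖) ^ 2 * ∑ s ∈ Finset.range T, ‖w s‖ ^ 2
      ≤ ∑ s ∈ Finset.range T, ‖w s - B (w (s + 1))‖ ^ 2 := by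
  have hshift : ∑ s ∈ Finset.range T, ‖w (s + 1)‖ ^ 2 ≤ ∑ s ∈ Finset.range T, ‖w s‖ ^ 2 := by
    have h1 := Finset.sum_range_succ (fun s => ‖w s‖ ^ 2) T
    have h2 := Finset.sum_range_succ' (fun s => ‖w s‖ ^ 2) T
    rw [hT, norm_zero] at h1
    nlinarith [sq_nonneg ‖w 0‖]
  have hB0 : 0 ≤ 1 - ‖B‖ := by linarith
  calc _ = (1 - ‖B‖) * (∑ s ∈ Finset.range T, ‖w s‖ ^ 2
          - ‖B‖ * ∑ s ∈ Finset.range T, ‖w s‖ ^ 2) := by ring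
    _ ≤ (1 - ‖B‖) * (∑ s ∈ Finset.range T, ‖w s‖ ^ 2
          - ‖B‖ * ∑ s ∈ Finset.range T, ‖w (s + 1)‖ ^ 2) := by gcongr
    _ = ∑ s ∈ Finset.range T, (1 - ‖B‖) * (‖w s‖ ^ 2 - ‖B‖ * ‖w (s + 1)‖ ^ 2) := by
        rw [← Finset.mul_sum, Finset.sum_sub_distrib, ← Finset.mul_sum]
    _ ≤ _ := Finset.sum_le_sum fun s _ =>
          le_norm_sub_sq_of_norm_le (norm_nonneg B) hB (B.le_opNorm _)

/-- Summation by parts: moving the adjoint and the shift onto x leaves x(s+1) - A x(s), which is the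
innovation. The boundary term vanishes since w T = 0. -/
lemma sum_inner_sub_adjoint_eq [CompleteSpace E] (A : E →L[ℝ] E) (x ξ w : ℕ → E) (T : ℕ)
    (h0 : 0 < T → x 0 = ξ 0)
    (hx : ∀ s, s + 1 < T → x (s + 1) = A (x s) + ξ (s + 1)) (hT : w T = 0) :
    ∑ s ∈ Finset.range T, inner ℝ (x s) (w s - ContinuousLinearMap.adjoint A (w (s + 1)))
      = ∑ s ∈ Finset.range T, inner ℝ (ξ s) (w s) := by
  rcases T with _ | T
  · simp
  simp only [inner_sub_right, ContinuousLinearMap.adjoint_inner_right, Finset.sum_sub_distrib]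
  rw [Finset.sum_range_succ (fun s => inner ℝ (A (x s)) (w (s + 1))), hT, inner_zero_right,
    add_zero, Finset.sum_range_succ', Finset.sum_range_succ', h0 (by omega),
    add_sub_right_comm, ← Finset.sum_sub_distrib]
  congr 1
  refine Finset.sum_congr rfl fun s hs => ?_
  rw [hx s (by simpa using hs), inner_add_left, add_sub_cancel_left]

end Duality

variable {T : ℕ}

lemma IsVAR.exists_dual (A : Matrix (Fin d) (Fin d) ℝ) (hA : specNorm A ≤ 1)
    (v : Fin T → EuclideanSpace ℝ (Fin d)) :
    ∃ w : Fin T → EuclideanSpace ℝ (Fin d),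
      (∀ ξ x, IsVAR A ξ x → ∑ s, inner ℝ (x s) (v s) = ∑ s, inner ℝ (ξ s) (w s)) ∧
      ∑ s, ‖v s‖ ^ 2 ≤ (1 + specNorm A) ^ 2 * ∑ s, ‖w s‖ ^ 2 ∧
      (1 - specNorm A) ^ 2 * ∑ s, ‖w s‖ ^ 2 ≤ ∑ s, ‖v s‖ ^ 2 := by
  set L := Matrix.toEuclideanCLM (n := Fin d) (𝕜 := ℝ) A with hL
  set B := ContinuousLinearMap.adjoint L
  have hB : ‖B‖ = specNorm A := ContinuousLinearMap.adjoint.norm_map L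
  obtain ⟨w, hT, hw⟩ := exists_backward_recursion B T (extendZero v)
  have hw' (s : Fin T) : v s = w s - B (w (s + 1)) := by
    rw [← hw s s.2, extendZero_val]
  have hr (f : ℕ → ℝ) : ∑ s : Fin T, f s = ∑ s ∈ Finset.range T, f s :=
    Fin.sum_univ_eq_sum_range f T
  refine ⟨fun s => w s, fun ξ x hx => ?_, ?_, ?_⟩
  · have h := sum_inner_sub_adjoint_eq L (extendZero x) (extendZero ξ) w T
      (fun h => by simpa [extendZero, h] using hx.1 h)
      (fun s hs => by
        have hs' : s < T := by omega
        simpa [extendZero, hs, hs'] using hx.2 s hs) hT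
    rw [← Fin.sum_univ_eq_sum_range (fun s => inner ℝ (extendZero x s) (w s - B (w (s + 1)))) T,
      ← Fin.sum_univ_eq_sum_range (fun s => inner ℝ (extendZero ξ s) (w s)) T] at h
    simp only [extendZero_val] at h
    simp_rw [hw']
    exact h
  · simp_rw [hw']
    rw [hr fun s => ‖w s - B (w (s + 1))‖ ^ 2, hr fun s => ‖w s‖ ^ 2, ← hB]
    exact sum_norm_sq_sub_le B hT
  · simp_rw [hw']
    rw [hr fun s => ‖w s - B (w (s + 1))‖ ^ 2, hr fun s => ‖w s‖ ^ 2, ← hB]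
    exact le_sum_norm_sq_sub B (hB.trans_le hA) hT

/-- The autoregressive series, as a sequence on `ℕ`, with given innovations. -/
noncomputable def varSeq (A : Matrix (Fin d) (Fin d) ℝ) (ξ : ℕ → EuclideanSpace ℝ (Fin d)) :
    ℕ → EuclideanSpace ℝ (Fin d)
  | 0 => ξ 0
  | t + 1 => Matrix.toEuclideanCLM (n := Fin d) (𝕜 := ℝ) A (varSeq A ξ t) + ξ (t + 1)

/-- The autoregressive series of length `T` with given innovations. -/
noncomputable def varPath (A : Matrix (Fin d) (Fin d) ℝ) (ξ : Fin T → EuclideanSpace ℝ (Fin d)) :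
    Fin T → EuclideanSpace ℝ (Fin d) :=
  fun t => varSeq A (extendZero ξ) t

lemma continuous_varPath (A : Matrix (Fin d) (Fin d) ℝ) :
    Continuous (varPath A : (Fin T → EuclideanSpace ℝ (Fin d)) → _) := by
  have h (t : ℕ) : Continuous fun ξ : Fin T → EuclideanSpace ℝ (Fin d) =>
      varSeq A (extendZero ξ) t := by
    induction t with
    | zero => exact continuous_extendZero 0
    | succ t ih =>
      exact ((ContinuousLinearMap.continuous _).comp ih).add (continuous_extendZero (t + 1))
  exact continuous_pi fun t => h t

lemma isVAR_varPath (A : Matrix (Fin d) (Fin d) ℝ) (ξ : Fin T → EuclideanSpace ℝ (Fin d)) :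
    IsVAR A ξ (varPath A ξ) := by
  refine ⟨fun h => ?_, fun t h => ?_⟩
  · simp [varPath, varSeq, extendZero, h]
  · simp [varPath, varSeq, extendZero, h]

lemma IsVAR.eq_varPath {A : Matrix (Fin d) (Fin d) ℝ} {ξ x : Fin T → EuclideanSpace ℝ (Fin d)}
    (hx : IsVAR A ξ x) : x = varPath A ξ := by
  have h (t : ℕ) : ∀ ht : t < T, x ⟨t, ht⟩ = varPath A ξ ⟨t, ht⟩ := by
    induction t with
    | zero => intro ht; rw [hx.1 ht, (isVAR_varPath A ξ).1 ht]
    | succ t ih => intro ht; rw [hx.2 t ht, (isVAR_varPath A ξ).2 t ht, ih]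
  exact funext fun t => h t t.2

/-! ### Increments along a path and around a cycle -/

section Increments

variable {E : Type*} [NormedAddCommGroup E]

lemma sum_norm_sq_extend_zero {κ ι : Type*} [Fintype κ] [Fintype ι] {f : κ → ι}
    (hf : Function.Injective f) (b : κ → E) :
    ∑ s, ‖(Function.extend f b 0 s : E)‖ ^ 2 = ∑ j, ‖b j‖ ^ 2 := by
  refine (Fintype.sum_of_injective f hf _ _ (fun s hs => ?_) fun j => ?_).symm
  · rw [Function.extend_apply' _ _ _ hs, Pi.zero_apply, norm_zero, zero_pow two_ne_zero]
  · rw [hf.extend_apply]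

/-- The increments around a cycle sum to zero, so the closing one is redundant. Dropping it leaves n
increments, the exponent in the final bound. -/
lemma sum_path_le_sum_cycle {n : ℕ} (X : Fin (n + 1) → E) :
    ∑ i : Fin n, ‖X i.succ - X i.castSucc‖ ^ 2 ≤ ∑ i, ‖X (i + 1) - X i‖ ^ 2 := by
  rw [Fin.sum_univ_castSucc (fun i : Fin (n + 1) => ‖X (i + 1) - X i‖ ^ 2)]
  simp only [Fin.coeSucc_eq_succ]
  exact le_add_of_nonneg_right (sq_nonneg _)

variable [InnerProductSpace ℝ E]

lemma sum_inner_extend_zero {κ ι : Type*} [Fintype κ] [Fintype ι] {f : κ → ι}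
    (hf : Function.Injective f) (b : κ → E) (x : ι → E) :
    ∑ s, inner ℝ (x s) (Function.extend f b 0 s) = ∑ j, inner ℝ (x (f j)) (b j) := by
  refine (Fintype.sum_of_injective f hf _ _ (fun s hs => ?_) fun j => ?_).symm
  · rw [Function.extend_apply' _ _ _ hs, Pi.zero_apply, inner_zero_right]
  · rw [hf.extend_apply]

/-- Abel summation. Extension by zero supplies the missing last term, while the start contributes
the boundary weight -η₀. -/
lemma sum_inner_increments {n : ℕ} (X : Fin (n + 1) → E) (η : Fin n → E) :
    ∑ i, inner ℝ (η i) (X i.succ - X i.castSucc)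
      = ∑ j, inner ℝ (X j) ((Fin.cons (-(extendZero η 0))
          (fun i : Fin n => η i - extendZero η (i + 1)) : Fin (n + 1) → E) j) := by
  have h1 := Fin.sum_univ_succ fun j : Fin (n + 1) => inner ℝ (X j) (extendZero η j)
  have h2 := Fin.sum_univ_castSucc fun j : Fin (n + 1) => inner ℝ (X j) (extendZero η j)
  simp only [Fin.val_zero, Fin.val_succ, Fin.val_castSucc, extendZero_val, Fin.val_last,
    extendZero_of_le η le_rfl, inner_zero_right, add_zero] at h1 h2
  rw [Fin.sum_univ_succ]
  simp only [Fin.cons_zero, Fin.cons_succ, inner_sub_right, inner_neg_right,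
    Finset.sum_sub_distrib, real_inner_comm]
  simp only [real_inner_comm] at h1 h2
  linarith

/-- The change of the assignment objective along the cycle through `f 0, f 1, …`. -/
noncomputable def cycleGain {ι : Type*} {n : ℕ} (σ : ℝ) (f : Fin (n + 1) → ι) (x x' : ι → E) : ℝ :=
  ∑ i, inner ℝ (x (f i) + σ • x' (f i)) (x (f (i + 1)) - x (f i))

/-- Polarization of the noiseless part: the terms ‖x‖² cancel around the cycle, leaving a pure
penalty. -/
lemma cycleGain_eq {ι : Type*} {n : ℕ} (σ : ℝ) (f : Fin (n + 1) → ι) (x x' : ι → E) :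
    cycleGain σ f x x' = -(∑ i, ‖x (f (i + 1)) - x (f i)‖ ^ 2) / 2
      + σ * ∑ i, inner ℝ (x' (f i)) (x (f (i + 1)) - x (f i)) := by
  have hrot : ∑ i : Fin (n + 1), ‖x (f (i + 1))‖ ^ 2 = ∑ i, ‖x (f i)‖ ^ 2 :=
    Equiv.sum_comp (Equiv.addRight (1 : Fin (n + 1))) fun i => ‖x (f i)‖ ^ 2
  have h (i : Fin (n + 1)) : inner ℝ (x (f i)) (x (f (i + 1)) - x (f i))
      = (‖x (f (i + 1))‖ ^ 2 - ‖x (f i)‖ ^ 2 - ‖x (f (i + 1)) - x (f i)‖ ^ 2) / 2 := by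
    rw [norm_sub_sq_real, inner_sub_right, real_inner_self_eq_norm_sq, real_inner_comm]
    ring
  simp only [cycleGain, inner_add_left, real_inner_smul_left, Finset.sum_add_distrib,
    Finset.mul_sum, h]
  rw [← Finset.sum_div, Finset.sum_sub_distrib, Finset.sum_sub_distrib, hrot]
  ring

end Increments

/-! ### Probability that a cycle is not penalized -/

/-- The square is linearized by writing the Gaussian as a characteristic function in an auxiliary η.
After exchanging the integrals, the exponent is linear in the innovations, so no covariance
determinant has to be computed. -/
lemma lintegral_exp_neg_path_le (A : Matrix (Fin d) (Fin d) ℝ) (hA : specNorm A ≤ 1) {n : ℕ}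
    {f : Fin (n + 1) → Fin T} (hf : Function.Injective f) {r : ℝ} (hr : 0 ≤ r) :
    ∫⁻ ξ, ENNReal.ofReal (Real.exp (-(r * ∑ i : Fin n,
        ‖varPath A ξ (f i.succ) - varPath A ξ (f i.castSucc)‖ ^ 2))) ∂(gaussianNoise d T)
      ≤ ENNReal.ofReal
        ((((1 + 2 * (r / (1 + specNorm A) ^ 2)) ^ (-(1 / 2) : ℝ)) ^ d) ^ n) := by
  set a := specNorm A with ha
  have ha0 : 0 ≤ a := norm_nonneg _
  set D : (Fin T → EuclideanSpace ℝ (Fin d)) → Fin n → EuclideanSpace ℝ (Fin d) :=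
    fun ξ i => varPath A ξ (f i.succ) - varPath A ξ (f i.castSucc) with hD
  have hc := continuous_varPath (T := T) A
  have hc' (s : Fin T) : Continuous fun ξ => varPath A ξ s := (continuous_apply s).comp hc
  have hDc (i : Fin n) : Continuous fun ξ => D ξ i := (hc' _).sub (hc' _)
  have hEc := continuous_incrementEnergy (d := d) (n := n)
  -- The scale √(2r) compensates the 1/2 in the Gaussian characteristic function, so that the
  -- η-average is exp(-r‖D‖²).
  set F : (Fin T → EuclideanSpace ℝ (Fin d)) → (Fin n → EuclideanSpace ℝ (Fin d)) → ℂ :=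
    fun ξ η => Complex.exp (((∑ i, inner ℝ (η i) (√(2 * r) • D ξ i) : ℝ) : ℂ) * Complex.I)
    with hF
  have hs : √(2 * r) ^ 2 = 2 * r := Real.sq_sqrt (by positivity)
  have hleft (ξ) : ∫ η, F ξ η ∂(gaussianNoise d n)
      = (Real.exp (-(r * ∑ i, ‖D ξ i‖ ^ 2)) : ℝ) := by
    rw [hF]
    simp only
    rw [integral_cexp_inner_gaussianNoise]
    simp only [norm_smul, mul_pow, Real.norm_eq_abs, sq_abs, hs, ← Finset.mul_sum]
    congr 2
    ring
  -- The weights that Abel summation puts on the times in the path, zero elsewhere, are transferred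
  -- to the innovations.
  choose W hW1 hW2 _ using fun η : Fin n → EuclideanSpace ℝ (Fin d) =>
    IsVAR.exists_dual A hA (Function.extend f (fun j => √(2 * r) •
      (Fin.cons (-(extendZero η 0)) (fun i : Fin n => η i - extendZero η (i + 1)) :
        Fin (n + 1) → EuclideanSpace ℝ (Fin d)) j) 0)
  have hright (η) : ∫ ξ, F ξ η ∂(gaussianNoise d T)
      = (Real.exp (-(∑ s, ‖W η s‖ ^ 2) / 2) : ℝ) := by
    rw [← integral_cexp_inner_gaussianNoise]
    congr 1
    funext ξ
    rw [hF]
    simp only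
    rw [← hW1 η ξ _ (isVAR_varPath A ξ), sum_inner_extend_zero hf]
    simp only [inner_smul_right, ← Finset.mul_sum]
    rw [← sum_inner_increments (fun j => varPath A ξ (f j))]
  have hW (η) : Real.exp (-(∑ s, ‖W η s‖ ^ 2) / 2)
      ≤ Real.exp (-(r / (1 + a) ^ 2 * incrementEnergy η)) := by
    rw [Real.exp_le_exp]
    have h := hW2 η
    rw [sum_norm_sq_extend_zero hf] at h
    simp only [norm_smul, mul_pow, Real.norm_eq_abs, sq_abs, hs, ← Finset.mul_sum] at h
    rw [Fin.sum_univ_succ] at h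
    simp only [Fin.cons_zero, Fin.cons_succ] at h
    change 2 * r * (_ + incrementEnergy η) ≤ _ at h
    have h3 : 2 * r * incrementEnergy η ≤ (1 + a) ^ 2 * ∑ s, ‖W η s‖ ^ 2 := by
      refine le_trans ?_ h
      gcongr
      -- The boundary weight ‖η₀‖² is dropped.
      exact le_add_of_nonneg_left (sq_nonneg _)
    rw [div_mul_eq_mul_div, ← neg_div, div_le_div_iff₀ (by norm_num) (by positivity)]
    linarith
  have hswap : ∫ ξ, Real.exp (-(r * ∑ i, ‖D ξ i‖ ^ 2)) ∂(gaussianNoise d T)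
      = ∫ η, Real.exp (-(∑ s, ‖W η s‖ ^ 2) / 2) ∂(gaussianNoise d n) := by
    have h : ∫ ξ, ∫ η, F ξ η ∂(gaussianNoise d n) ∂(gaussianNoise d T)
        = ∫ η, ∫ ξ, F ξ η ∂(gaussianNoise d T) ∂(gaussianNoise d n) := by
      refine integral_integral_swap (Integrable.of_bound
        (Continuous.aestronglyMeasurable ?_) 1 (Eventually.of_forall fun p => ?_))
      · have h1 (i : Fin n) : Continuous fun p : (Fin T → EuclideanSpace ℝ (Fin d)) ×
            (Fin n → EuclideanSpace ℝ (Fin d)) => D p.1 i := (hDc i).comp continuous_fst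
        simp only [hF, Function.uncurry_def]
        fun_prop
      · simp only [hF, Function.uncurry_def]
        rw [Complex.norm_exp_ofReal_mul_I]
    simp_rw [hleft, hright, integral_complex_ofReal] at h
    exact_mod_cast h
  have hr' : 0 ≤ r / (1 + a) ^ 2 := by positivity
  have hint : Integrable (fun η => Real.exp (-(r / (1 + a) ^ 2 * incrementEnergy η)))
      (gaussianNoise d n) := by
    refine Integrable.of_bound (Continuous.aestronglyMeasurable (by fun_prop)) 1
      (Eventually.of_forall fun η => ?_)
    rw [Real.norm_of_nonneg (Real.exp_pos _).le, Real.exp_le_one_iff, neg_nonpos]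
    exact mul_nonneg hr' (Finset.sum_nonneg fun i _ => sq_nonneg _)
  calc _ = ENNReal.ofReal (∫ ξ, Real.exp (-(r * ∑ i, ‖D ξ i‖ ^ 2)) ∂(gaussianNoise d T)) := by
        rw [ofReal_integral_eq_lintegral_ofReal]
        · refine Integrable.of_bound (Continuous.aestronglyMeasurable (by fun_prop)) 1
            (Eventually.of_forall fun η => ?_)
          rw [Real.norm_of_nonneg (Real.exp_pos _).le, Real.exp_le_one_iff, neg_nonpos]
          positivity
        · exact Eventually.of_forall fun z => (Real.exp_pos _).le
    _ ≤ ENNReal.ofReal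
          (∫ η, Real.exp (-(r / (1 + a) ^ 2 * incrementEnergy η)) ∂(gaussianNoise d n)) := by
        rw [hswap]
        exact ENNReal.ofReal_le_ofReal (integral_mono_of_nonneg
          (Eventually.of_forall fun η => (Real.exp_pos _).le) hint (Eventually.of_forall hW))
    _ = ∫⁻ η, ENNReal.ofReal (Real.exp (-(r / (1 + a) ^ 2 * incrementEnergy η)))
          ∂(gaussianNoise d n) :=
        ofReal_integral_eq_lintegral_ofReal hint
          (Eventually.of_forall fun z => (Real.exp_pos _).le)
    _ ≤ _ := lintegral_exp_neg_mul_incrementEnergy_le hr' n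

lemma continuous_cycleGain_varPath (A : Matrix (Fin d) (Fin d) ℝ) (σ : ℝ) {n : ℕ}
    (f : Fin (n + 1) → Fin T) :
    Continuous fun p : (Fin T → EuclideanSpace ℝ (Fin d)) × (Fin T → EuclideanSpace ℝ (Fin d)) =>
      cycleGain σ f (varPath A p.1) (varPath A p.2) := by
  have hc (s : Fin T) : Continuous fun ξ => varPath A ξ s :=
    (continuous_apply s).comp (continuous_varPath (T := T) A)
  unfold cycleGain
  exact continuous_finsetSum _ fun i _ => Continuous.inner
    (((hc _).comp continuous_fst).add (((hc _).comp continuous_snd).const_smul σ))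
    (((hc _).comp continuous_fst).sub ((hc _).comp continuous_fst))

/-- Chernoff bound with parameter θ. Given the innovations of x, the noise term is Gaussian with
variance at most σ²S/(1 - a)², so the exponential moment is at most exp(-rS); S is then replaced by
the smaller path sum. -/
lemma measure_cycleGain_nonneg_le_lintegral (A : Matrix (Fin d) (Fin d) ℝ) (hA : specNorm A < 1)
    {n : ℕ} {f : Fin (n + 1) → Fin T} (hf : Function.Injective f) (σ : ℝ) {r θ : ℝ} (hr : 0 ≤ r)
    (hθ : 0 ≤ θ) (hrθ : r ≤ θ / 2 - θ ^ 2 * σ ^ 2 / (2 * (1 - specNorm A) ^ 2)) :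
    ((gaussianNoise d T).prod (gaussianNoise d T))
        {p | 0 ≤ cycleGain σ f (varPath A p.1) (varPath A p.2)}
      ≤ ∫⁻ ξ, ENNReal.ofReal (Real.exp (-(r * ∑ i : Fin n,
        ‖varPath A ξ (f i.succ) - varPath A ξ (f i.castSucc)‖ ^ 2))) ∂(gaussianNoise d T) := by
  have hg : Measurable fun p : (Fin T → EuclideanSpace ℝ (Fin d)) ×
      (Fin T → EuclideanSpace ℝ (Fin d)) => ENNReal.ofReal (Real.exp
        (θ * cycleGain σ f (varPath A p.1) (varPath A p.2))) :=
    (Real.measurable_exp.comp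
      ((continuous_cycleGain_varPath A σ f).measurable.const_mul θ)).ennreal_ofReal
  have ha : 0 < 1 - specNorm A := by linarith
  calc _ ≤ ∫⁻ p, ENNReal.ofReal (Real.exp
            (θ * cycleGain σ f (varPath A p.1) (varPath A p.2)))
            ∂((gaussianNoise d T).prod (gaussianNoise d T)) := by
        refine meas_le_lintegral₀ hg.aemeasurable fun p hp => ?_
        rw [ENNReal.one_le_ofReal, Real.one_le_exp_iff]
        exact mul_nonneg hθ hp
    _ = ∫⁻ ξ, ∫⁻ ξ', ENNReal.ofReal (Real.exp
            (θ * cycleGain σ f (varPath A ξ) (varPath A ξ')))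
            ∂(gaussianNoise d T) ∂(gaussianNoise d T) :=
        lintegral_prod _ hg.aemeasurable
    _ ≤ _ := by
        refine lintegral_mono fun ξ => ?_
        set x := varPath A ξ
        set S := ∑ i, ‖x (f (i + 1)) - x (f i)‖ ^ 2 with hS
        obtain ⟨w, hw1, -, hw2⟩ := IsVAR.exists_dual A hA.le
          (Function.extend f (fun i => (θ * σ) • (x (f (i + 1)) - x (f i))) 0)
        rw [sum_norm_sq_extend_zero hf] at hw2
        simp only [norm_smul, mul_pow, Real.norm_eq_abs, sq_abs, ← Finset.mul_sum, ← hS] at hw2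
        have h (ξ') : ENNReal.ofReal (Real.exp (θ * cycleGain σ f x (varPath A ξ')))
            = ENNReal.ofReal (Real.exp (-(θ / 2 * S)))
              * ENNReal.ofReal (Real.exp (∑ s, inner ℝ (ξ' s) (w s))) := by
          rw [← ENNReal.ofReal_mul (Real.exp_pos _).le, ← Real.exp_add,
            ← hw1 ξ' _ (isVAR_varPath A ξ'), sum_inner_extend_zero hf, cycleGain_eq]
          simp only [inner_smul_right, ← Finset.mul_sum, ← hS]
          congr 2
          ring
        simp_rw [h]
        rw [lintegral_const_mul _ (by fun_prop), lintegral_exp_inner_gaussianNoise,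
          ← ENNReal.ofReal_mul (Real.exp_pos _).le, ← Real.exp_add]
        refine ENNReal.ofReal_le_ofReal (Real.exp_le_exp.2 ?_)
        have hS0 : 0 ≤ S := Finset.sum_nonneg fun i _ => sq_nonneg _
        have h1 : ∑ s, ‖w s‖ ^ 2 ≤ θ ^ 2 * σ ^ 2 * S / (1 - specNorm A) ^ 2 := by
          rw [le_div_iff₀ (by positivity)]
          linarith
        have h2 := mul_le_mul_of_nonneg_left
          (sum_path_le_sum_cycle fun i => x (f i)) hr
        have h3 := mul_le_mul_of_nonneg_right hrθ hS0
        have h4 : θ ^ 2 * σ ^ 2 / (2 * (1 - specNorm A) ^ 2) * S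
            = θ ^ 2 * σ ^ 2 * S / (1 - specNorm A) ^ 2 / 2 := by
          field_simp
        rw [sub_mul, h4] at h3
        linarith

lemma errorFactor_nonneg {a : ℝ} (ha : a ≤ 1) (d : ℕ) (σ : ℝ) : 0 ≤ errorFactor d a σ := by
  unfold errorFactor
  have : 0 ≤ 1 - a := by linarith
  split_ifs <;> positivity

lemma measure_cycleGain_nonneg_le (hd : 1 ≤ d) (A : Matrix (Fin d) (Fin d) ℝ)
    (hA : specNorm A < 1) {n : ℕ} {f : Fin (n + 1) → Fin T} (hf : Function.Injective f) (σ : ℝ) :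
    ((gaussianNoise d T).prod (gaussianNoise d T))
        {p | 0 ≤ cycleGain σ f (varPath A p.1) (varPath A p.2)}
      ≤ ENNReal.ofReal (errorFactor d (specNorm A) σ ^ n) := by
  set a := specNorm A with ha
  have ha0 : 0 ≤ a := norm_nonneg _
  have ha1 : 0 < 1 - a := by linarith
  by_cases hσ : σ = 0
  · rcases Nat.eq_zero_or_pos n with rfl | hn
    · simpa using prob_le_one
    -- Without noise the choice θ = 2r is admissible for every r, so letting r tend to infinity
    -- gives probability zero; this needs n and d positive.
    have hlim : Tendsto (fun r : ℝ => ENNReal.ofReal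
        ((((1 + 2 * (r / (1 + a) ^ 2)) ^ (-(1 / 2) : ℝ)) ^ d) ^ n)) atTop (𝓝 0) := by
      rw [← ENNReal.ofReal_zero]
      refine ENNReal.tendsto_ofReal ?_
      have h1 : Tendsto (fun r : ℝ => 1 + 2 * (r / (1 + a) ^ 2)) atTop atTop :=
        tendsto_atTop_add_const_left _ _
          ((tendsto_id.atTop_div_const (by positivity)).const_mul_atTop (by norm_num))
      have h2 := (((tendsto_rpow_neg_atTop (y := 1 / 2) (by norm_num)).comp h1).pow d).pow n
      rwa [zero_pow (by omega), zero_pow (by omega)] at h2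
    refine (ge_of_tendsto hlim ?_).trans zero_le
    filter_upwards [eventually_ge_atTop 0] with r hr
    refine (measure_cycleGain_nonneg_le_lintegral A hA hf σ (θ := 2 * r) hr (by positivity)
      ?_).trans (lintegral_exp_neg_path_le A hA.le hf hr)
    simp [hσ]
  · have hσ2 : 0 < σ ^ 2 := by positivity
    set r := (1 - a) ^ 2 / (8 * σ ^ 2) with hr
    have hr0 : 0 ≤ r := by positivity
    -- This θ maximizes the quadratic θ/2 - θ²σ²/(2(1 - a)²), and r is its maximum.
    refine (measure_cycleGain_nonneg_le_lintegral A hA hf σ (r := r)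
      (θ := (1 - a) ^ 2 / (2 * σ ^ 2)) hr0 (by positivity) ?_).trans
      ((lintegral_exp_neg_path_le A hA.le hf hr0).trans ?_)
    · rw [hr, ← ha]
      apply le_of_eq
      field_simp
      ring
    · refine ENNReal.ofReal_le_ofReal ?_
      have hm : 0 ≤ (1 - a) ^ 5 / (4 * σ ^ 2) := by positivity
      -- The fifth power comes from trading 1/(1 + a)² for the smaller (1 - a)³.
      have hbase : (1 - a) ^ 5 / (4 * σ ^ 2) + 1 ≤ 1 + 2 * (r / (1 + a) ^ 2) := by
        have h1 : (1 - a) ^ 3 * (1 + a) ^ 2 ≤ 1 := by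
          have h2 : (1 - a) ^ 3 * (1 + a) ^ 2 = (1 - a) * ((1 - a ^ 2) ^ 2) := by ring
          rw [h2]
          have h3 : (1 - a ^ 2) ^ 2 ≤ 1 := by
            rw [sq_le_one_iff_abs_le_one, abs_le]
            constructor <;> nlinarith
          nlinarith
        have h4 : 2 * (r / (1 + a) ^ 2) = (1 - a) ^ 2 / (4 * σ ^ 2) / (1 + a) ^ 2 := by
          rw [hr]
          field_simp
          norm_num
        have h5 : (1 - a) ^ 5 / (4 * σ ^ 2) ≤ 2 * (r / (1 + a) ^ 2) := by
          rw [h4, le_div_iff₀ (by positivity), div_mul_eq_mul_div]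
          gcongr
          nlinarith [sq_nonneg (1 - a)]
        linarith
      have herr : errorFactor d a σ
          = (((1 - a) ^ 5 / (4 * σ ^ 2) + 1) ^ (-(1 / 2) : ℝ)) ^ d := by
        rw [errorFactor, if_neg hσ, ← Real.rpow_mul_natCast (by positivity)]
        congr 1
        ring
      rw [herr]
      refine pow_le_pow_left₀ (by positivity) (pow_le_pow_left₀ (by positivity) ?_ d) n
      exact Real.rpow_le_rpow_of_nonpos (by positivity) hbase (by norm_num)

/-! ### Mismatches of the linear assignment estimator -/

lemma frobeniusInner_mul_permMatrix (X Xs : Matrix (Fin d) (Fin T) ℝ) (τ : Equiv.Perm (Fin T)) :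
    frobeniusInner (Xs * Equiv.Perm.permMatrix ℝ τ) X = ∑ t, ∑ i, Xs i t * X i (τ t) := by
  rw [frobeniusInner, Matrix.trace, ← Equiv.sum_comp τ]
  refine Finset.sum_congr rfl fun t _ => ?_
  simp only [Matrix.diag_apply, Matrix.mul_apply, Matrix.transpose_apply,
    Equiv.Perm.permMatrix, PEquiv.toMatrix_apply, Equiv.toPEquiv_apply, Option.mem_def,
    Option.some.injEq, EmbeddingLike.apply_eq_iff_eq, mul_ite, mul_one, mul_zero,
    Finset.sum_ite_eq', Finset.mem_univ, if_true]

/-- Compare ρ with the permutation that fixes the cycle through s and agrees with ρ elsewhere: the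
objectives differ exactly by the sum along the cycle, listed as the orbit of s. -/
lemma Equiv.Perm.exists_cycle_sum_nonneg {ι : Type*} [Fintype ι] [DecidableEq ι]
    (ρ : Equiv.Perm ι) (h : ι → ι → ℝ) (hρ : ∀ τ : Equiv.Perm ι, ∑ s, h s (τ s) ≤ ∑ s, h s (ρ s))
    {s : ι} (hs : ρ s ≠ s) :
    ∃ n, 1 ≤ n ∧ ∃ f : Fin (n + 1) → ι, Function.Injective f ∧ f 0 = s ∧
      0 ≤ ∑ i, (h (f i) (f (i + 1)) - h (f i) (f i)) := by
  have hper : s ∈ Function.periodicPts ρ := by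
    refine Function.mk_mem_periodicPts (orderOf_pos ρ) ?_
    rw [Function.IsPeriodicPt, Function.IsFixedPt, ← Equiv.Perm.coe_pow, pow_orderOf_eq_one]
    rfl
  have hpos := Function.minimalPeriod_pos_of_mem_periodicPts hper
  obtain ⟨n, hn⟩ : ∃ n, Function.minimalPeriod ρ s = n + 1 := ⟨_, (Nat.succ_pred hpos.ne').symm⟩
  have hn1 : 1 ≤ n := by
    by_contra hlt
    have : Function.minimalPeriod ρ s = 1 := by omega
    exact hs (Function.minimalPeriod_eq_one_iff_isFixedPt.1 this)
  set f : Fin (n + 1) → ι := fun i => ρ^[i] s with hf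
  have hinj : Function.Injective f := by
    intro i j hij
    have := (Function.iterate_eq_iterate_iff_of_lt_minimalPeriod (f := ρ) (x := s)
      (m := i) (n := j) (by omega) (by omega)).1 hij
    exact Fin.ext this
  have hmod (m : ℕ) : ρ^[m] s = f ⟨m % (n + 1), Nat.mod_lt _ n.succ_pos⟩ := by
    simp only [hf, ← hn, Function.iterate_mod_minimalPeriod_eq]
  have hstep (i : Fin (n + 1)) : ρ (f i) = f (i + 1) := by
    rw [hf]
    simp only
    rw [← Function.iterate_succ_apply' ρ, hmod]
    congr 1
    ext
    simp [Fin.val_add]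
  have hrange (y : ι) : ρ.SameCycle s y ↔ y ∈ Set.range f := by
    constructor
    · intro hy
      obtain ⟨m, -, hm⟩ := hy.exists_pow_eq'
      rw [← hm, Equiv.Perm.coe_pow, hmod]
      exact ⟨_, rfl⟩
    · rintro ⟨i, rfl⟩
      exact ⟨i, by rw [zpow_natCast, Equiv.Perm.coe_pow]⟩
  refine ⟨n, hn1, f, hinj, by simp [hf], ?_⟩
  have hcyc (y : ι) : ((ρ.cycleOf s)⁻¹ * ρ) y = if ρ.SameCycle s y then y else ρ y := by
    rw [Equiv.Perm.mul_apply, Equiv.Perm.inv_eq_iff_eq]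
    split_ifs with hy
    · rw [hy.cycleOf_apply]
    · rw [Equiv.Perm.cycleOf_apply_of_not_sameCycle]
      rwa [Equiv.Perm.sameCycle_apply_right]
  have hsum : ∑ i, (h (f i) (f (i + 1)) - h (f i) (f i))
      = ∑ y, (h y (ρ y) - h y (((ρ.cycleOf s)⁻¹ * ρ) y)) := by
    refine Fintype.sum_of_injective f hinj _ _ (fun y hy => ?_) fun i => ?_
    · rw [hcyc, if_neg (by rwa [hrange]), sub_self]
    · rw [hcyc, if_pos ((hrange _).2 ⟨i, rfl⟩), hstep]
  rw [hsum, Finset.sum_sub_distrib, sub_nonneg]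
  exact hρ _

open Classical in
/-- The injective tuples of `n + 1` times whose cycle does not decrease the objective. -/
noncomputable def gainingCycles (σ : ℝ) (n : ℕ) (x x' : Fin T → EuclideanSpace ℝ (Fin d)) :
    Finset (Fin (n + 1) → Fin T) :=
  Finset.univ.filter fun f => Function.Injective f ∧ 0 ≤ cycleGain σ f x x'

/-- Each mismatched t is charged to a gaining cycle that starts at π t. Starting points determine t,
so the charging is injective. -/
lemma IsLinearAssignment.card_mismatch_le {X Xs : Matrix (Fin d) (Fin T) ℝ}
    {π πhat : Equiv.Perm (Fin T)} {σ : ℝ} {x x' : Fin T → EuclideanSpace ℝ (Fin d)}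
    (hX : ∀ i t, X i t = x t i) (hXs : ∀ i t, Xs i t = (x (π t) + σ • x' (π t)) i)
    (hLA : IsLinearAssignment X Xs πhat) :
    (mismatch πhat π).card ≤ ∑ n ∈ Finset.Ico 1 T, (gainingCycles σ n x x').card := by
  classical
  have hobj (τ : Equiv.Perm (Fin T)) : frobeniusInner (Xs * Equiv.Perm.permMatrix ℝ τ) X
      = ∑ s, inner ℝ (x s + σ • x' s) (x ((τ * π⁻¹) s)) := by
    rw [frobeniusInner_mul_permMatrix,
      ← Equiv.sum_comp π fun s => inner ℝ (x s + σ • x' s) (x ((τ * π⁻¹) s))]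
    refine Finset.sum_congr rfl fun t _ => ?_
    rw [PiLp.inner_apply]
    refine Finset.sum_congr rfl fun i _ => ?_
    rw [hX, hXs, show (τ * π⁻¹) (π t) = τ t by simp]
    exact mul_comm _ _
  have hsub : (mismatch πhat π).image π ⊆ (Finset.Ico 1 T).biUnion fun n =>
      (gainingCycles σ n x x').image fun f => f 0 := by
    intro s hs
    obtain ⟨t, ht, rfl⟩ := Finset.mem_image.1 hs
    have ht' : (πhat * π⁻¹) (π t) ≠ π t := by
      simpa [mismatch] using ht
    obtain ⟨n, hn, f, hf, hf0, hgain⟩ := Equiv.Perm.exists_cycle_sum_nonneg (πhat * π⁻¹)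
      (fun s y => inner ℝ (x s + σ • x' s) (x y)) (fun τ => by
        have := hLA (τ * π)
        rwa [hobj, hobj, mul_inv_cancel_right] at this) ht'
    have hnT : n + 1 ≤ T := by simpa using Fintype.card_le_of_injective f hf
    refine Finset.mem_biUnion.2 ⟨n, Finset.mem_Ico.2 ⟨hn, by omega⟩,
      Finset.mem_image.2 ⟨f, ?_, hf0⟩⟩
    simp only [gainingCycles, Finset.mem_filter, Finset.mem_univ, true_and]
    refine ⟨hf, ?_⟩
    simp only [cycleGain, inner_sub_right]
    exact hgain
  calc (mismatch πhat π).card = ((mismatch πhat π).image π).card :=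
        (Finset.card_image_of_injective _ π.injective).symm
    _ ≤ _ := Finset.card_le_card hsub
    _ ≤ _ := Finset.card_biUnion_le
    _ ≤ _ := Finset.sum_le_sum fun n _ => Finset.card_image_le

-- Expected number of mismatches

lemma IsCVAR.exists_hasLaw {Ω : Type*} [MeasurableSpace Ω] {P : Measure Ω} [IsProbabilityMeasure P]
    {A : Matrix (Fin d) (Fin d) ℝ} {π : Equiv.Perm (Fin T)} {σ : ℝ}
    {X Xs : Ω → Matrix (Fin d) (Fin T) ℝ} (h : IsCVAR P A π σ X Xs) :
    ∃ Φ : Ω → (Fin T → EuclideanSpace ℝ (Fin d)) × (Fin T → EuclideanSpace ℝ (Fin d)),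
      HasLaw Φ ((gaussianNoise d T).prod (gaussianNoise d T)) P ∧
      (∀ ω i t, X ω i t = varPath A (Φ ω).1 t i) ∧
      ∀ ω i t, Xs ω i t = (varPath A (Φ ω).1 (π t) + σ • varPath A (Φ ω).2 (π t)) i := by
  obtain ⟨ξ, ξ', x, x', hind, hξ, hξ', hx⟩ := h
  refine ⟨fun ω => (fun t => ξ t ω, fun t => ξ' t ω), ?_, fun ω i t => ?_, fun ω i t => ?_⟩
  · have hlaw (j : Fin T ⊕ Fin T) : HasLaw (Sum.elim ξ ξ' j)
        (stdGaussian (EuclideanSpace ℝ (Fin d))) P := by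
      cases j with
      | inl t => exact hξ t
      | inr t => exact hξ' t
    have hpi := hind.hasLaw_pi hlaw
    have hmp := measurePreserving_sumPiEquivProdPi
      (fun _ : Fin T ⊕ Fin T => stdGaussian (EuclideanSpace ℝ (Fin d)))
    exact HasLaw.comp ⟨hmp.measurable.aemeasurable, hmp.map_eq⟩ hpi
  · rw [(hx ω).2.2.1, ← (hx ω).1.eq_varPath]
  · rw [(hx ω).2.2.2, ← (hx ω).1.eq_varPath, ← (hx ω).2.1.eq_varPath]

lemma lintegral_card_gainingCycles_le (hd : 1 ≤ d) (A : Matrix (Fin d) (Fin d) ℝ)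
    (hA : specNorm A < 1) (σ : ℝ) (n : ℕ) :
    ∫⁻ p, ((gainingCycles σ n (varPath A p.1) (varPath A p.2)).card : ENNReal)
        ∂((gaussianNoise d T).prod (gaussianNoise d T))
      ≤ ENNReal.ofReal ((T : ℝ) ^ (n + 1) * errorFactor d (specNorm A) σ ^ n) := by
  classical
  have hms (f : Fin (n + 1) → Fin T) : MeasurableSet {p : (Fin T → EuclideanSpace ℝ (Fin d)) ×
      (Fin T → EuclideanSpace ℝ (Fin d)) | 0 ≤ cycleGain σ f (varPath A p.1) (varPath A p.2)} :=
    measurableSet_le measurable_const (continuous_cycleGain_varPath A σ f).measurable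
  have h (p : (Fin T → EuclideanSpace ℝ (Fin d)) × (Fin T → EuclideanSpace ℝ (Fin d))) :
      ((gainingCycles σ n (varPath A p.1) (varPath A p.2)).card : ENNReal)
      ≤ ∑ f : Fin (n + 1) → Fin T, if Function.Injective f then
        Set.indicator {p | 0 ≤ cycleGain σ f (varPath A p.1) (varPath A p.2)} 1 p else 0 := by
    rw [gainingCycles, Finset.card_filter, Nat.cast_sum]
    refine Finset.sum_le_sum fun f _ => ?_
    by_cases hf : Function.Injective f <;>
      simp [hf, Set.indicator_apply]
  refine (lintegral_mono h).trans ?_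
  rw [lintegral_finsetSum _ fun f _ => by
    split_ifs
    · exact measurable_one.indicator (hms f)
    · exact measurable_const]
  calc _ ≤ ∑ _f : Fin (n + 1) → Fin T,
          ENNReal.ofReal (errorFactor d (specNorm A) σ ^ n) := by
        refine Finset.sum_le_sum fun f _ => ?_
        by_cases hf : Function.Injective f
        · simp only [hf, if_true]
          rw [lintegral_indicator_one (hms f)]
          exact measure_cycleGain_nonneg_le hd A hA hf σ
        · simp [hf]
    _ = _ := by
        rw [Finset.sum_const, Finset.card_univ, Fintype.card_fun, Fintype.card_fin,
          Fintype.card_fin, nsmul_eq_mul, ENNReal.ofReal_mul (by positivity),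
          ← ENNReal.ofReal_natCast, Nat.cast_pow]

lemma measurable_card_mismatch {Ω : Type*} [MeasurableSpace Ω] {πhat : Ω → Equiv.Perm (Fin T)}
    (hmeas : ∀ p, MeasurableSet (πhat ⁻¹' {p})) (π : Equiv.Perm (Fin T)) :
    Measurable fun ω => ((mismatch (πhat ω) π).card : ℝ) := by
  let _ : MeasurableSpace (Equiv.Perm (Fin T)) := ⊤
  have h : Measurable πhat := measurable_to_countable' hmeas
  exact (measurable_from_top (f := fun p => ((mismatch p π).card : ℝ))).comp h

lemma integrable_card_mismatch {Ω : Type*} [MeasurableSpace Ω] {P : Measure Ω} [IsFiniteMeasure P]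
    {πhat : Ω → Equiv.Perm (Fin T)}
    (hmeas : ∀ p, MeasurableSet (πhat ⁻¹' {p})) (π : Equiv.Perm (Fin T)) :
    Integrable (fun ω => ((mismatch (πhat ω) π).card : ℝ)) P := by
  refine Integrable.of_bound (measurable_card_mismatch hmeas π).aestronglyMeasurable T
    (Eventually.of_forall fun ω => ?_)
  rw [Real.norm_natCast]
  exact_mod_cast (Finset.card_le_univ _).trans_eq (Fintype.card_fin T)

lemma sum_Ico_pow_le {q : ℝ} (hq : 0 ≤ q) (hq2 : q ≤ 1 / 2) (T : ℕ) :
    ∑ n ∈ Finset.Ico 1 T, q ^ n ≤ 2 * q := by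
  rw [Finset.sum_Ico_eq_sum_range]
  calc _ ≤ ∑ n ∈ Finset.range (T - 1), q * (1 / 2) ^ n := by
        refine Finset.sum_le_sum fun n _ => ?_
        rw [pow_add, pow_one]
        gcongr
    _ ≤ q * 2 := by
        rw [← Finset.mul_sum]
        gcongr
        exact sum_geometric_two_le _
    _ = _ := mul_comm _ _

/-- The sum of T (Tu)^n starts at n = 1, since fixed points are not mismatches, and the geometric
series is at most twice its first term. -/
lemma integral_card_mismatch_le {Ω : Type*} [MeasurableSpace Ω] {P : Measure Ω}
    [IsProbabilityMeasure P] (hd : 1 ≤ d) {A : Matrix (Fin d) (Fin d) ℝ} (hA : specNorm A < 1)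
    {π : Equiv.Perm (Fin T)} {σ : ℝ} {X Xs : Ω → Matrix (Fin d) (Fin T) ℝ}
    (hmodel : IsCVAR P A π σ X Xs) {πhat : Ω → Equiv.Perm (Fin T)}
    (hmeas : ∀ p, MeasurableSet (πhat ⁻¹' {p}))
    (hLA : ∀ᵐ ω ∂P, IsLinearAssignment (X ω) (Xs ω) (πhat ω))
    (hsmall : T * errorFactor d (specNorm A) σ ≤ 1 / 2) :
    ∫ ω, ((mismatch (πhat ω) π).card : ℝ) ∂P
      ≤ 2 * (errorFactor d (specNorm A) σ * (T : ℝ) ^ 2) := by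
  classical
  obtain ⟨Φ, hΦ, hX, hXs⟩ := hmodel.exists_hasLaw
  set u := errorFactor d (specNorm A) σ
  have hu : 0 ≤ u := errorFactor_nonneg hA.le d σ
  have hmg (n : ℕ) : Measurable fun p : (Fin T → EuclideanSpace ℝ (Fin d)) ×
      (Fin T → EuclideanSpace ℝ (Fin d)) =>
        ((gainingCycles σ n (varPath A p.1) (varPath A p.2)).card : ENNReal) := by
    simp only [gainingCycles, Finset.card_filter, Nat.cast_sum]
    refine Finset.measurable_sum _ fun f _ => ?_
    by_cases hf : Function.Injective f
    · simp only [hf, true_and, Nat.cast_ite, Nat.cast_one, Nat.cast_zero]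
      exact Measurable.ite (measurableSet_le measurable_const
        (continuous_cycleGain_varPath A σ f).measurable) measurable_const measurable_const
    · simp [hf]
  have hsum : ∑ n ∈ Finset.Ico 1 T, (T : ℝ) ^ (n + 1) * u ^ n ≤ 2 * (u * (T : ℝ) ^ 2) := by
    calc _ = T * ∑ n ∈ Finset.Ico 1 T, (T * u) ^ n := by
          rw [Finset.mul_sum]
          exact Finset.sum_congr rfl fun n _ => by ring
      _ ≤ T * (2 * (T * u)) := by
          gcongr
          exact sum_Ico_pow_le (by positivity) hsmall T
      _ = _ := by ring
  have key : ENNReal.ofReal (∫ ω, ((mismatch (πhat ω) π).card : ℝ) ∂P)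
      ≤ ENNReal.ofReal (2 * (u * (T : ℝ) ^ 2)) := by
    rw [ofReal_integral_eq_lintegral_ofReal (integrable_card_mismatch hmeas π)
      (Eventually.of_forall fun ω => Nat.cast_nonneg _)]
    calc _ ≤ ∫⁻ ω, ∑ n ∈ Finset.Ico 1 T,
            ((gainingCycles σ n (varPath A (Φ ω).1) (varPath A (Φ ω).2)).card : ENNReal) ∂P := by
          refine lintegral_mono_ae ?_
          filter_upwards [hLA] with ω hω
          rw [ENNReal.ofReal_natCast]
          exact_mod_cast hω.card_mismatch_le (hX ω) (hXs ω)
      _ = ∫⁻ p, ∑ n ∈ Finset.Ico 1 T,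
            ((gainingCycles σ n (varPath A p.1) (varPath A p.2)).card : ENNReal)
            ∂((gaussianNoise d T).prod (gaussianNoise d T)) :=
          hΦ.lintegral_comp (f := fun p => ∑ n ∈ Finset.Ico 1 T,
            ((gainingCycles σ n (varPath A p.1) (varPath A p.2)).card : ENNReal))
            (Finset.measurable_sum _ fun n _ => hmg n).aemeasurable
      _ = _ := lintegral_finsetSum _ fun n _ => hmg n
      _ ≤ ∑ n ∈ Finset.Ico 1 T, ENNReal.ofReal ((T : ℝ) ^ (n + 1) * u ^ n) :=
          Finset.sum_le_sum fun n _ => lintegral_card_gainingCycles_le hd A hA σ n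
      _ = ENNReal.ofReal (∑ n ∈ Finset.Ico 1 T, (T : ℝ) ^ (n + 1) * u ^ n) :=
          (ENNReal.ofReal_sum_of_nonneg fun n _ => by positivity).symm
      _ ≤ _ := ENNReal.ofReal_le_ofReal hsum
  exact (ENNReal.ofReal_le_ofReal_iff (by positivity)).1 key

/-- Markov's inequality, read on the complement. -/
lemma one_sub_integral_card_mismatch_div_le {Ω : Type*} [MeasurableSpace Ω] {P : Measure Ω}
    [IsProbabilityMeasure P] {π : Equiv.Perm (Fin T)} {πhat : Ω → Equiv.Perm (Fin T)}
    (hmeas : ∀ p, MeasurableSet (πhat ⁻¹' {p})) {r : ℝ} (hr : 0 < r) {s : Set Ω}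
    (hs : ∀ ω, ((mismatch (πhat ω) π).card : ℝ) < r → ω ∈ s) :
    1 - (∫ ω, ((mismatch (πhat ω) π).card : ℝ) ∂P) / r ≤ P.real s := by
  have h1 := mul_meas_ge_le_integral_of_nonneg
    (Eventually.of_forall fun ω => Nat.cast_nonneg (mismatch (πhat ω) π).card)
    (integrable_card_mismatch (P := P) hmeas π) r
  have h2 : P.real Set.univ ≤ P.real (s ∪ {ω | r ≤ ((mismatch (πhat ω) π).card : ℝ)}) := by
    refine measureReal_mono fun ω _ => ?_
    rcases lt_or_ge ((mismatch (πhat ω) π).card : ℝ) r with h | h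
    · exact Or.inl (hs ω h)
    · exact Or.inr h
  have h3 := h2.trans (measureReal_union_le _ _)
  rw [probReal_univ] at h3
  have h4 := (le_div_iff₀' hr).2 h1
  linarith

-- From the noise level to the three regimes

lemma errorFactor_le (hd : 1 ≤ d) {a σ w p : ℝ} (hT : 1 ≤ T)
    (hgt : 1 < (2 : ℝ) ^ w * (T : ℝ) ^ p)
    (h : σ ^ 2 ≤ (1 - a) ^ 5 / (4 * (sZero d ^ w * (T : ℝ) ^ (p / (d : ℝ)) - 1))) :
    errorFactor d a σ ≤ (2 : ℝ) ^ (-w / 2) * (T : ℝ) ^ (-p / 2) := by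
  have hd0 : (0 : ℝ) < d := by exact_mod_cast hd
  have hT0 : (0 : ℝ) < T := by exact_mod_cast hT
  have hbase : sZero d ^ w * (T : ℝ) ^ (p / (d : ℝ))
      = ((2 : ℝ) ^ w * (T : ℝ) ^ p) ^ (1 / (d : ℝ)) := by
    rw [sZero, Real.mul_rpow (by positivity) (by positivity), ← Real.rpow_mul (by norm_num),
      ← Real.rpow_mul (by norm_num), ← Real.rpow_mul hT0.le]
    congr 2 <;> ring
  rw [errorFactor]
  split_ifs with hσ
  · positivity
  have hσ2 : 0 < σ ^ 2 := by positivity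
  -- Positivity of the denominator is what allows the bound on σ² to be inverted.
  have hs1 : 1 < sZero d ^ w * (T : ℝ) ^ (p / (d : ℝ)) := by
    rw [hbase]
    exact Real.one_lt_rpow hgt (by positivity)
  have hle : sZero d ^ w * (T : ℝ) ^ (p / (d : ℝ)) ≤ (1 - a) ^ 5 / (4 * σ ^ 2) + 1 := by
    rw [le_div_iff₀ (by linarith)] at h
    rw [← sub_le_iff_le_add, le_div_iff₀ (by positivity)]
    linarith
  calc _ ≤ (sZero d ^ w * (T : ℝ) ^ (p / (d : ℝ))) ^ (-(d : ℝ) / 2) :=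
        Real.rpow_le_rpow_of_nonpos (by linarith) hle (by linarith)
    _ = _ := by
        rw [hbase, ← Real.rpow_mul (by positivity), Real.mul_rpow (by positivity) (by positivity),
          ← Real.rpow_mul (by norm_num), ← Real.rpow_mul hT0.le]
        congr 2 <;> field_simp

theorem mainTheorem1
    (d : ℕ → ℕ) (hd : ∀ T, 1 ≤ d T)
    (A : ∀ T, Matrix (Fin (d T)) (Fin (d T)) ℝ) (hA : ∀ T, specNorm (A T) < 1)
    (πstar : ∀ T, Equiv.Perm (Fin T))
    (σ : ℕ → ℝ) (hσ : ∀ T, 0 ≤ σ T)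
    {Ω : ℕ → Type*} [∀ T, MeasurableSpace (Ω T)]
    (P : ∀ T, Measure (Ω T)) [∀ T, IsProbabilityMeasure (P T)]
    (X Xs : ∀ T, Ω T → Matrix (Fin (d T)) (Fin T) ℝ)
    (hmodel : ∀ T, IsCVAR (P T) (A T) (πstar T) (σ T) (X T) (Xs T))
    (πhat : ∀ T, Ω T → Equiv.Perm (Fin T))
    (hmeas : ∀ T p, MeasurableSet (πhat T ⁻¹' {p}))
    (hLA : ∀ T, ∀ᵐ ω ∂(P T), IsLinearAssignment (X T ω) (Xs T ω) (πhat T ω)) :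
    -- (i) exact recovery
    (∀ w : ℕ → ℝ, Tendsto w atTop atTop →
      (∀ᶠ T : ℕ in atTop, (σ T) ^ 2 ≤ (1 - specNorm (A T)) ^ 5 /
        (4 * (sZero (d T) ^ (w T) * (T : ℝ) ^ (4 / (d T : ℝ)) - 1))) →
      Tendsto (fun T => ∫ ω, ((mismatch (πhat T ω) (πstar T)).card : ℝ) ∂(P T)) atTop (𝓝 0) ∧
      Tendsto (fun T => (P T).real {ω | (mismatch (πhat T ω) (πstar T)).card = 0})
        atTop (𝓝 1)) ∧
    -- (ii) bounded error
    (∀ c : ℕ → ℝ, c =O[atTop] (fun _ => (1 : ℝ)) →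
      (∀ᶠ T : ℕ in atTop, (σ T) ^ 2 ≤ (1 - specNorm (A T)) ^ 5 /
        (4 * (sZero (d T) ^ (c T) * (T : ℝ) ^ (4 / (d T : ℝ)) - 1))) →
      (fun T => ∫ ω, ((mismatch (πhat T ω) (πstar T)).card : ℝ) ∂(P T))
        =O[atTop] (fun _ => (1 : ℝ)) ∧
      ∀ f : ℕ → ℝ, Tendsto f atTop atTop →
        Tendsto (fun T => (P T).real {ω | ((mismatch (πhat T ω) (πstar T)).card : ℝ) ≤ f T})
          atTop (𝓝 1)) ∧
    -- (iii) sublinear error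
    (∀ w : ℕ → ℝ, Tendsto w atTop atTop →
      (∀ᶠ T : ℕ in atTop, (σ T) ^ 2 ≤ (1 - specNorm (A T)) ^ 5 /
        (4 * (sZero (d T) ^ (w T) * (T : ℝ) ^ (2 / (d T : ℝ)) - 1))) →
      (fun T => ∫ ω, ((mismatch (πhat T ω) (πstar T)).card : ℝ) ∂(P T))
        =O[atTop] (fun T => errorFactor (d T) (specNorm (A T)) (σ T) * (T : ℝ) ^ 2)) := by
  have hu0 (T : ℕ) : 0 ≤ errorFactor (d T) (specNorm (A T)) (σ T) :=
    errorFactor_nonneg (hA T).le _ _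
  have hE (T : ℕ) (hT : T * errorFactor (d T) (specNorm (A T)) (σ T) ≤ 1 / 2) :=
    integral_card_mismatch_le (hd T) (hA T) (hmodel T) (hmeas T) (hLA T) hT
  have hE0 (T : ℕ) : 0 ≤ ∫ ω, ((mismatch (πhat T ω) (πstar T)).card : ℝ) ∂(P T) :=
    integral_nonneg fun ω => Nat.cast_nonneg _
  have hTlarge : Tendsto (fun T : ℕ => (T : ℝ)) atTop atTop := tendsto_natCast_atTop_atTop
  -- the common bound of the first two regimes
  have hmain (w : ℕ → ℝ) (C : ℝ) (hw : ∀ᶠ T in atTop, -C ≤ w T)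
      (h : ∀ᶠ T : ℕ in atTop, (σ T) ^ 2 ≤ (1 - specNorm (A T)) ^ 5 /
        (4 * (sZero (d T) ^ (w T) * (T : ℝ) ^ (4 / (d T : ℝ)) - 1))) :
      ∀ᶠ T in atTop, ∫ ω, ((mismatch (πhat T ω) (πstar T)).card : ℝ) ∂(P T)
        ≤ 2 * (2 : ℝ) ^ (-w T / 2) := by
    -- The second threshold on T gives Tu ≤ 1/2; the third makes 2^w T⁴ > 1.
    filter_upwards [hw, h, eventually_ge_atTop 1,
      hTlarge.eventually_ge_atTop (2 * (2 : ℝ) ^ (C / 2)),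
      hTlarge.eventually_gt_atTop ((2 : ℝ) ^ C)] with T hw h hT1 hT2 hT3
    have hT1' : (1 : ℝ) ≤ T := by exact_mod_cast hT1
    have hT0 : (0 : ℝ) < T := by linarith
    have hgt : 1 < (2 : ℝ) ^ (w T) * (T : ℝ) ^ (4 : ℝ) := by
      calc (1 : ℝ) = (2 : ℝ) ^ (-C) * (2 : ℝ) ^ C := by
            rw [← Real.rpow_add (by norm_num)]
            simp
        _ < (2 : ℝ) ^ (-C) * T := by gcongr
        _ ≤ (2 : ℝ) ^ (w T) * (T : ℝ) ^ (4 : ℝ) := by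
            gcongr
            · norm_num
            · exact Real.self_le_rpow_of_one_le hT1' (by norm_num)
    have hu := errorFactor_le (hd T) hT1 hgt h
    have hT2' : (T : ℝ) ^ (-4 / 2 : ℝ) = ((T : ℝ) ^ 2)⁻¹ := by
      rw [show (-4 / 2 : ℝ) = -(2 : ℕ) by norm_num, Real.rpow_neg hT0.le, Real.rpow_natCast]
    rw [hT2'] at hu
    have hw2 : (2 : ℝ) ^ (-w T / 2) ≤ (2 : ℝ) ^ (C / 2) :=
      Real.rpow_le_rpow_of_exponent_le (by norm_num) (by linarith)
    have hsmall : T * errorFactor (d T) (specNorm (A T)) (σ T) ≤ 1 / 2 := by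
      calc _ ≤ T * ((2 : ℝ) ^ (-w T / 2) * ((T : ℝ) ^ 2)⁻¹) := by gcongr
        _ = (2 : ℝ) ^ (-w T / 2) / T := by field_simp
        _ ≤ 1 / 2 := by
            rw [div_le_div_iff₀ hT0 (by norm_num)]
            linarith
    calc _ ≤ _ := hE T hsmall
      _ ≤ 2 * ((2 : ℝ) ^ (-w T / 2) * ((T : ℝ) ^ 2)⁻¹ * (T : ℝ) ^ 2) := by gcongr
      _ = _ := by field_simp
  refine ⟨fun w hw h => ?_, fun c hc h => ?_, fun w hw h => ?_⟩
  · have hlim : Tendsto (fun T => ∫ ω, ((mismatch (πhat T ω) (πstar T)).card : ℝ) ∂(P T))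
        atTop (𝓝 0) := by
      refine tendsto_of_tendsto_of_tendsto_of_le_of_le' tendsto_const_nhds ?_
        (Eventually.of_forall hE0) (hmain w 0 (hw.eventually_ge_atTop _) h)
      have h1 : Tendsto (fun T => -w T / 2) atTop atBot :=
        (tendsto_neg_atTop_atBot.comp hw).atBot_div_const (by norm_num)
      simpa using ((tendsto_rpow_atBot_of_base_gt_one 2 (by norm_num)).comp h1).const_mul (2 : ℝ)
    refine ⟨hlim, tendsto_of_tendsto_of_tendsto_of_le_of_le (by simpa using hlim.const_sub 1)
      tendsto_const_nhds (fun T => ?_) fun T => measureReal_le_one⟩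
    have := one_sub_integral_card_mismatch_div_le (P := P T) (π := πstar T) (hmeas T) one_pos
      (s := {ω | (mismatch (πhat T ω) (πstar T)).card = 0}) fun ω hω => by
        have : (mismatch (πhat T ω) (πstar T)).card < 1 := by exact_mod_cast hω
        exact Nat.lt_one_iff.1 this
    simpa using this
  · obtain ⟨C, hC⟩ := hc.bound
    have hbd : ∀ᶠ T in atTop, ∫ ω, ((mismatch (πhat T ω) (πstar T)).card : ℝ) ∂(P T)
        ≤ 2 * (2 : ℝ) ^ (C / 2) := by
      have hC' : ∀ᶠ T in atTop, -C ≤ c T := by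
        filter_upwards [hC] with T hT
        rw [norm_one, mul_one, Real.norm_eq_abs] at hT
        exact (abs_le.1 hT).1
      filter_upwards [hmain c C hC' h, hC'] with T hT hT'
      refine hT.trans ?_
      gcongr
      · norm_num
      · linarith
    refine ⟨IsBigO.of_bound (2 * (2 : ℝ) ^ (C / 2)) ?_, fun f hf => ?_⟩
    · filter_upwards [hbd] with T hT
      rwa [norm_one, mul_one, Real.norm_of_nonneg (hE0 T)]
    · have hlim : Tendsto (fun T => 1 - 2 * (2 : ℝ) ^ (C / 2) / f T) atTop (𝓝 1) := by
        simpa using (hf.const_div_atTop (2 * (2 : ℝ) ^ (C / 2))).const_sub 1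
      refine tendsto_of_tendsto_of_tendsto_of_le_of_le' hlim tendsto_const_nhds ?_
        (Eventually.of_forall fun T => measureReal_le_one)
      filter_upwards [hbd, hf.eventually_gt_atTop 0] with T hT hfT
      refine le_trans ?_ (one_sub_integral_card_mismatch_div_le (P := P T) (π := πstar T)
        (hmeas T) hfT fun ω hω => hω.le)
      gcongr
  · refine IsBigO.of_bound 2 ?_
    -- Here Tu ≤ 2^(-w/2), so w ≥ 2 is exactly what yields Tu ≤ 1/2.
    filter_upwards [h, eventually_ge_atTop 1, hw.eventually_ge_atTop 2] with T h hT1 hwT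
    have hT1' : (1 : ℝ) ≤ T := by exact_mod_cast hT1
    have hT0 : (0 : ℝ) < T := by linarith
    have hgt : 1 < (2 : ℝ) ^ (w T) * (T : ℝ) ^ (2 : ℝ) :=
      one_lt_mul_of_lt_of_le (Real.one_lt_rpow (by norm_num) (by linarith))
        (Real.one_le_rpow hT1' (by norm_num))
    have hu := errorFactor_le (hd T) hT1 hgt h
    have hT2' : (T : ℝ) ^ (-2 / 2 : ℝ) = (T : ℝ)⁻¹ := by
      rw [show (-2 / 2 : ℝ) = -1 by norm_num, Real.rpow_neg_one]
    rw [hT2'] at hu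
    have hsmall : T * errorFactor (d T) (specNorm (A T)) (σ T) ≤ 1 / 2 := by
      calc _ ≤ T * ((2 : ℝ) ^ (-w T / 2) * (T : ℝ)⁻¹) := by gcongr
        _ = (2 : ℝ) ^ (-w T / 2) := by field_simp
        _ ≤ (2 : ℝ) ^ (-1 : ℝ) :=
            Real.rpow_le_rpow_of_exponent_le (by norm_num) (by linarith)
        _ = 1 / 2 := by norm_num [Real.rpow_neg_one]
    rw [Real.norm_of_nonneg (hE0 T), Real.norm_of_nonneg (mul_nonneg (hu0 T) (by positivity))]
    exact hE T hsmall
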